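/- \textbf{Theorem (Learning Stackelberg in linear bandit games).} \emph{Setting.} A linear bandit game has finite nonempty action sets $\mathcal A$ (leader) and $\mathcal B$ (follower), a known feature map $\phi:\mathcal A\times\mathcal B\to\mathbb R^d$ ($d\ge 1$) and unknown $\theta_1^\star,\theta_2^\star\in\mathbb R^d$. A query of $(a,b)$ returns a fresh independent sample of the reward pair $r_i(a,b)=\phi(a,b)^\top\theta_i^\star+z_i$, $i=1,2$, where $z_1,z_2$ are mean-zero and $1$-sub-Gaussian, i.e. $\mathbb E e^{tz_i}\le e^{t^2/2}$ for all $t\in\mathbb R$ (the joint law of $(z_1,z_2)$ may depend on $(a,b)$). Let $\mu_i(a,b)=\mathbb E[r_i(a,b)]$. For $\eta\ge0$ put \[ \mathsf{BR}_\eta(a)=\{b:\mu_2(a,b)\ge\max_{b'}\mu_2(a,b')-\eta\},\qquad \phi_\eta(a)=\min_{b\in\mathsf{BR}_\eta(a)}\mu_1(a,b),\qquad \mathsf{gap}_\eta=\max_a\phi_0(a)-\max_a\phi_\eta(a). \] \emph{Core set.} A core set is a set $\mathcal K\subseteq\mathcal A\times\mathcal B$ with a probability vector $\rho$ on $\mathcal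 K$ such that, with $G=\sum_{(a,b)\in\mathcal K}\rho(a,b)\phi(a,b)\phi(a,b)^\top$, \[ \max_{(a,b)\in\mathcal A\times\mathcal B}\phi(a,b)^\top G^{-1}\phi(a,b)\le 2d,\qquad |\mathcal K|\le 4d\log\log d+16 , \] where $4d\log\log d$ is read as $0$ for $d=1$, and, if $G$ is singular (the features do not span $\mathbb R^d$), all $\phi(a,b)$ are required to lie in the range of $G$ and $G^{-1}$ is the pseudo-inverse. \emph{Algorithm} (with constant $C$, accuracy $\varepsilon$, confidence $\delta$). Take a core set $(\mathcal K,\rho)$; query each pair of $\mathcal K$ exactly $N=\lceil C\,d\log(2d/\delta)/\varepsilon^2\rceil$ times and let $\hat\mu_i(a,b)$, $(a,b)\in\mathcal K$, be the empirical means of the rewards; let \[ \hat\theta_i\in\arg\min_{\theta\in\mathbb R^d}\sum_{(a,b)\in\mathcal K}\rho(a,b)\bigl(\phi(a,b)^\top\theta-\hat\mu_i(a,b)\bigr)^2,\qquad i=1,2; \] let $\widehat{\mathsf{BR}}(a)=\{b:\phi(a,b)^\top\hat\theta_2\ge\max_{b'}\phi(a,b')^\top\hat\theta_2-3\varepsilon/4\}$,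 and output \[ \hat a\in\arg\max_{a}\ \min_{b\in\widehat{\mathsf{BR}}(a)}\phi(a,b)^\top\hat\theta_1,\qquad \hat b\in\arg\min_{b\in\widehat{\mathsf{BR}}(\hat a)}\phi(\hat a,b)^\top\hat\theta_1 , \] ties being broken arbitrarily. \emph{Claim.} There are absolute constants $C,C'>0$ such that for every linear bandit game and all $\varepsilon,\delta\in(0,1)$ a core set exists and, for every choice of the core set, the algorithm always has an output, and with probability at least $1-\delta$ every output $(\hat a,\hat b)$ (for all ways of breaking ties) satisfies \[ \phi_0(\hat a)\ \ge\ \phi_{\varepsilon/2}(\hat a)\ \ge\ \max_{a\in\mathcal A}\phi_0(a)-\mathsf{gap}_\varepsilon-\varepsilon ,\qquad \hat b\in\mathsf{BR}_\varepsilon(\hat a). \] The number of queries $n=N|\mathcal K|$ satisfies \[ n\ \le\ \frac{C'\,d^2\,\log(2d/\delta)\,\bigl(1+\log(1+\log d)\bigr)}{\varepsilon^2}=\widetilde O(d^2/\varepsilon^2). \] -/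

import Mathlib

namespace Stackelberg

open MeasureTheory ProbabilityTheory Matrix

/-! Stackelberg notions for a pair of payoff functions `u₁` (leader), `u₂` (follower). -/

section Payoffs

variable {A B : Type*}

/-- The `η`-approximate best responses of the follower to the leader action `a`:
all `b` with `u₂ a b ≥ max_{b'} u₂ a b' - η`. -/
def bestResponse (u₂ : A → B → ℝ) (η : ℝ) (a : A) : Set B :=
  {b | (⨆ b' : B, u₂ a b') - η ≤ u₂ a b}

/-- The leader's value of `a` under the worst `η`-approximate best response:
the minimum of `u₁ a b` over `b ∈ bestResponse u₂ η a`. -/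
noncomputable def leaderValue (u₁ u₂ : A → B → ℝ) (η : ℝ) (a : A) : ℝ :=
  sInf (u₁ a '' bestResponse u₂ η a)

/-- `gap_ε = max_a φ₀(a) - max_a φ_ε(a)`. -/
noncomputable def gap (u₁ u₂ : A → B → ℝ) (ε : ℝ) : ℝ :=
  (⨆ a : A, leaderValue u₁ u₂ 0 a) - ⨆ a : A, leaderValue u₁ u₂ ε a

end Payoffs

/-- A linear bandit game with leader actions `A`, follower actions `B` and `d`-dimensional
features. Player `0 : Fin 2` is the leader, player `1` the follower. `noise a b` is the joint law
of the noise pair of one query of `(a, b)`; the two components may be dependent and the law may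
depend on `(a, b)`. -/
structure LinearBanditGame (A B : Type*) (d : ℕ) where
  /-- the (known) feature map -/
  feature : A → B → Fin d → ℝ
  /-- the (unknown) parameters of the two players -/
  theta : Fin 2 → Fin d → ℝ
  /-- the (unknown) joint law of the noise of the two players -/
  noise : A → B → Measure (Fin 2 → ℝ)
  noise_prob : ∀ a b, IsProbabilityMeasure (noise a b)
  noise_mean : ∀ a b i, ∫ z, z i ∂(noise a b) = 0
  noise_subgaussian : ∀ a b i, HasSubgaussianMGF (fun z : Fin 2 → ℝ => z i) 1 (noise a b)

namespace LinearBanditGame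

variable {A B : Type*} {d : ℕ} (M : LinearBanditGame A B d)

/-- The reward pair `r_i = φ(a,b)ᵀ θ_i + z_i` as a function of the noise pair `z`. -/
def reward (a : A) (b : B) (z : Fin 2 → ℝ) : Fin 2 → ℝ :=
  fun i => M.feature a b ⬝ᵥ M.theta i + z i

/-- The law of the reward pair observed in one query of `(a, b)`. -/
noncomputable def rewardLaw (a : A) (b : B) : Measure (Fin 2 → ℝ) :=
  (M.noise a b).map (M.reward a b)

instance (a : A) (b : B) : IsProbabilityMeasure (M.rewardLaw a b) := by
  have := M.noise_prob a b
  unfold rewardLaw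
  refine Measure.isProbabilityMeasure_map (Measurable.aemeasurable ?_)
  unfold reward
  fun_prop

/-- The mean reward `μ_i(a,b) = 𝔼[r_i(a,b)]`. -/
noncomputable def mean (i : Fin 2) (a : A) (b : B) : ℝ :=
  ∫ r, r i ∂(M.rewardLaw a b)

end LinearBanditGame

section Algorithm

/-! The algorithm. Its ingredients depend on the game only through the known feature map `φ`. -/

variable {A B : Type*} {d : ℕ}

/-- The design matrix `∑_{(a,b) ∈ 𝒦} ρ(a,b) φ(a,b) φ(a,b)ᵀ`. -/
noncomputable def designMatrix (φ : A → B → Fin d → ℝ) (𝒦 : Finset (A × B)) (ρ : 𝒦 → ℝ) :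
    Matrix (Fin d) (Fin d) ℝ :=
  ∑ p : 𝒦, ρ p • vecMulVec (φ p.1.1 p.1.2) (φ p.1.1 p.1.2)

/-- `xᵀ G⁻¹ x ≤ c`. For invertible `G` this is literal (`invQuadFormLE_iff`); a singular symmetric
`G` is read with its pseudo-inverse on its range, `x` being required to lie in that range. The
value `x ⬝ᵥ w` does not depend on the choice of the solution `w` of `G w = x`. -/
def InvQuadFormLE (G : Matrix (Fin d) (Fin d) ℝ) (x : Fin d → ℝ) (c : ℝ) : Prop :=
  ∃ w : Fin d → ℝ, G *ᵥ w = x ∧ x ⬝ᵥ w ≤ c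

theorem invQuadFormLE_iff (G : Matrix (Fin d) (Fin d) ℝ) (hG : IsUnit G.det) (x : Fin d → ℝ)
    (c : ℝ) : InvQuadFormLE G x c ↔ x ⬝ᵥ (G⁻¹ *ᵥ x) ≤ c := by
  constructor
  · rintro ⟨w, rfl, h⟩
    rwa [mulVec_mulVec, nonsing_inv_mul G hG, one_mulVec]
  · intro h
    exact ⟨G⁻¹ *ᵥ x, by rw [mulVec_mulVec, mul_nonsing_inv G hG, one_mulVec], h⟩

/-- `(𝒦, ρ)` is a valid result of the core set subroutine: `ρ` is a probability vector on `𝒦`,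
every feature satisfies `φᵀ (∑ ρ φ φᵀ)⁻¹ φ ≤ 2 d`, and `|𝒦| ≤ 4 d log log d + 16`
(for `d = 1` the first term is `0`, since `Real.log 0 = 0`). -/
def IsCoreSet (φ : A → B → Fin d → ℝ) (𝒦 : Finset (A × B)) (ρ : 𝒦 → ℝ) : Prop :=
  ρ ∈ stdSimplex ℝ 𝒦 ∧
  (∀ a b, InvQuadFormLE (designMatrix φ 𝒦 ρ) (φ a b) (2 * d)) ∧
  (𝒦.card : ℝ) ≤ 4 * d * Real.log (Real.log d) + 16

/-- The number of times each pair of the core set is queried. -/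
noncomputable def repetitions (C : ℝ) (d : ℕ) (ε δ : ℝ) : ℕ :=
  ⌈C * d * Real.log (2 * d / δ) / ε ^ 2⌉₊

/-- The queries: one for each pair of `𝒦` and each `n : Fin N`. -/
abbrev Query (𝒦 : Finset (A × B)) (N : ℕ) : Type _ := 𝒦 × Fin N

/-- The observations: one reward pair for each query. -/
abbrev Observations (𝒦 : Finset (A × B)) (N : ℕ) : Type _ := Query 𝒦 N → Fin 2 → ℝ

/-- The law of the observations: independent samples, one from the reward law of each query. -/
noncomputable def LinearBanditGame.observationLaw (M : LinearBanditGame A B d)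
    (𝒦 : Finset (A × B)) (N : ℕ) : Measure (Observations 𝒦 N) :=
  Measure.pi fun q : Query 𝒦 N => M.rewardLaw q.1.1.1 q.1.1.2

/-- The empirical mean of the observed rewards of player `i` at the core set pair `p`. -/
noncomputable def empiricalMean {𝒦 : Finset (A × B)} {N : ℕ} (X : Observations 𝒦 N) (i : Fin 2)
    (p : 𝒦) : ℝ :=
  (∑ n : Fin N, X (p, n) i) / N

/-- `θ` is a weighted least squares estimate for the targets `m`. -/
def IsWeightedLeastSquares (φ : A → B → Fin d → ℝ) (𝒦 : Finset (A × B)) (ρ : 𝒦 → ℝ) (m : 𝒦 → ℝ)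
    (θ : Fin d → ℝ) : Prop :=
  ∀ θ' : Fin d → ℝ,
    ∑ p : 𝒦, ρ p * (φ p.1.1 p.1.2 ⬝ᵥ θ - m p) ^ 2 ≤
      ∑ p : 𝒦, ρ p * (φ p.1.1 p.1.2 ⬝ᵥ θ' - m p) ^ 2

/-- `(a, b)` is an output of the algorithm on the observations `X`, for some way of breaking the
ties in the three minimizations / maximizations: `θ i` are weighted least squares estimates, `a`
maximizes the estimated leader value at level `3ε/4`, and `b` minimizes the estimated leader reward
over the estimated `3ε/4`-best responses to `a`. -/
def IsOutput (φ : A → B → Fin d → ℝ) (𝒦 : Finset (A × B)) (ρ : 𝒦 → ℝ) {N : ℕ} (ε : ℝ)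
    (X : Observations 𝒦 N) (a : A) (b : B) : Prop :=
  ∃ θ : Fin 2 → Fin d → ℝ,
    (∀ i, IsWeightedLeastSquares φ 𝒦 ρ (empiricalMean X i) (θ i)) ∧
    (∀ a', leaderValue (fun a b => φ a b ⬝ᵥ θ 0) (fun a b => φ a b ⬝ᵥ θ 1) (3 * ε / 4) a' ≤
      leaderValue (fun a b => φ a b ⬝ᵥ θ 0) (fun a b => φ a b ⬝ᵥ θ 1) (3 * ε / 4) a) ∧
    b ∈ bestResponse (fun a b => φ a b ⬝ᵥ θ 1) (3 * ε / 4) a ∧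
    ∀ b' ∈ bestResponse (fun a b => φ a b ⬝ᵥ θ 1) (3 * ε / 4) a,
      φ a b ⬝ᵥ θ 0 ≤ φ a b' ⬝ᵥ θ 0

end Algorithm

end Stackelberg

namespace Stackelberg

open MeasureTheory ProbabilityTheory Matrix

/-! The argument separates a design problem, a statistical estimate and a deterministic comparison.
Core set: among families of `k = 2r + 1` features (repetitions allowed, `r` the dimension of their
span), take one maximizing the determinant of the information matrix. No exchange of one vector
increases it, and summing these exchange inequalities bounds every leverage by `r / (k - r + 1)`
(`leverage_le_of_exchange_optimal`). The empirical weights of the family form a core set of at most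
`2r + 1` pairs (`exists_isCoreSet`); no approximate design algorithm is needed. Statistics:
sub-Gaussian tails and a union bound make all empirical means on the core set `t`-accurate. Writing
`φ = G w`, the normal equations and Cauchy–Schwarz in the weights `ρ` carry this to every pair at
the cost of a factor `√(2d)` (`abs_sub_le_of_isWeightedLeastSquares`). The choice of `t` makes all
predictions `ε/8`-accurate. Comparison: such predictions sandwich the estimated `3ε/4`-best
responses between the true `ε/2`- and `ε`-best responses, so the estimated optimum competes with
`max φ_ε` (`leaderValue_le_add_of_close`). -/

/-! ### Exchange-optimal designs and existence of core sets -/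

/-- The unnormalized information matrix `∑ᵢ vᵢ vᵢᵀ` of a finite family of vectors. -/
noncomputable def infoMatrix {ι : Type*} [Fintype ι] {r : ℕ} (v : ι → Fin r → ℝ) :
    Matrix (Fin r) (Fin r) ℝ :=
  ∑ i, vecMulVec (v i) (v i)

theorem vecMulVec_mulVec_eq_smul {d : ℕ} (u v w : Fin d → ℝ) :
    vecMulVec u v *ᵥ w = (v ⬝ᵥ w) • u := by
  ext i
  simp [vecMulVec_mulVec, mul_comm]

theorem dotProduct_infoMatrix_mulVec {ι : Type*} [Fintype ι] {r : ℕ} (v : ι → Fin r → ℝ)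
    (x y : Fin r → ℝ) : x ⬝ᵥ (infoMatrix v *ᵥ y) = ∑ i, (v i ⬝ᵥ x) * (v i ⬝ᵥ y) := by
  simp only [infoMatrix, sum_mulVec, dotProduct_sum, vecMulVec_mulVec_eq_smul, dotProduct_smul,
    smul_eq_mul]
  exact Finset.sum_congr rfl fun i _ => by rw [dotProduct_comm x (v i), mul_comm]

theorem transpose_infoMatrix {ι : Type*} [Fintype ι] {r : ℕ} (v : ι → Fin r → ℝ) :
    (infoMatrix v)ᵀ = infoMatrix v := by
  simp [infoMatrix, transpose_sum, transpose_vecMulVec]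

theorem posDef_infoMatrix {ι : Type*} [Fintype ι] {r : ℕ} (v : ι → Fin r → ℝ)
    (hv : Submodule.span ℝ (Set.range v) = ⊤) : (infoMatrix v).PosDef := by
  refine PosDef.of_dotProduct_mulVec_pos (transpose_infoMatrix v) fun x hx => ?_
  have key : x ⬝ᵥ (infoMatrix v *ᵥ x) = ∑ i, (v i ⬝ᵥ x) ^ 2 := by
    rw [dotProduct_infoMatrix_mulVec]; simp [sq]
  rw [star_trivial, key]
  refine lt_of_le_of_ne (Finset.sum_nonneg fun i _ => sq_nonneg _) fun h0 => hx ?_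
  have h1 : ∀ i, v i ⬝ᵥ x = 0 := fun i => by
    have := (Finset.sum_eq_zero_iff_of_nonneg (fun i _ => sq_nonneg (v i ⬝ᵥ x))).1 h0.symm i
      (Finset.mem_univ i)
    simpa using this
  have h2 : ∀ y ∈ Submodule.span ℝ (Set.range v), y ⬝ᵥ x = 0 := fun y hy => by
    induction hy using Submodule.span_induction with
    | mem y hy => obtain ⟨i, rfl⟩ := hy; exact h1 i
    | zero => simp
    | add y z _ _ h h' => rw [add_dotProduct, h, h', add_zero]
    | smul a y _ h => rw [smul_dotProduct, h, smul_zero]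
  exact dotProduct_self_eq_zero.1 (h2 x (hv ▸ Submodule.mem_top))

/-- The swap is a rank-two update `M + U * V`, so the matrix determinant lemma leaves a 2 × 2
determinant; symmetry of `M` turns its off-diagonal product into a square. -/
theorem det_swap_rank_one {r : ℕ} (M : Matrix (Fin r) (Fin r) ℝ) (hM : IsUnit M.det)
    (hsymm : Mᵀ = M) (v x : Fin r → ℝ) :
    (M - vecMulVec v v + vecMulVec x x).det =
      M.det * ((1 - v ⬝ᵥ (M⁻¹ *ᵥ v)) * (1 + x ⬝ᵥ (M⁻¹ *ᵥ x)) + (v ⬝ᵥ (M⁻¹ *ᵥ x)) ^ 2) := by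
  let U : Matrix (Fin r) (Fin 2) ℝ := of fun i j => ![-v i, x i] j
  let V : Matrix (Fin 2) (Fin r) ℝ := of ![v, x]
  have h1 : M - vecMulVec v v + vecMulVec x x = M + U * V := by
    ext i j
    simp [U, V, Matrix.mul_apply, Fin.sum_univ_two, vecMulVec_apply]
    ring
  have hU0 : Uᵀ 0 = -v := by ext i; simp [U]
  have hU1 : Uᵀ 1 = x := by ext i; simp [U]
  have hent : ∀ i j, (V * M⁻¹ * U) i j = V i ⬝ᵥ (M⁻¹ *ᵥ Uᵀ j) := fun i j => by
    rw [Matrix.mul_assoc]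
    rfl
  have hV0 : V 0 = v := rfl
  have hV1 : V 1 = x := rfl
  have hinv : x ⬝ᵥ (M⁻¹ *ᵥ v) = v ⬝ᵥ (M⁻¹ *ᵥ x) := by
    rw [dotProduct_mulVec, ← mulVec_transpose, transpose_nonsing_inv, hsymm, dotProduct_comm]
  rw [h1, det_add_mul U V hM, det_fin_two]
  simp only [Matrix.add_apply, hent, hU0, hU1, hV0, hV1, mulVec_neg, dotProduct_neg, one_apply_eq, hinv,
    one_apply_ne (show (0 : Fin 2) ≠ 1 by decide), one_apply_ne (show (1 : Fin 2) ≠ 0 by decide)]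
  ring

theorem infoMatrix_update {ι : Type*} [Fintype ι] [DecidableEq ι] {r : ℕ} (v : ι → Fin r → ℝ)
    (i : ι) (x : Fin r → ℝ) :
    infoMatrix (Function.update v i x) =
      infoMatrix v - vecMulVec (v i) (v i) + vecMulVec x x := by
  unfold infoMatrix
  rw [← Finset.add_sum_erase _ _ (Finset.mem_univ i),
    ← Finset.add_sum_erase Finset.univ (fun j => vecMulVec (v j) (v j)) (Finset.mem_univ i),
    Finset.sum_congr rfl fun j hj => by
      rw [Function.update_of_ne (Finset.ne_of_mem_erase hj)], Function.update_self]
  abel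

/-- The sum is the trace of `M⁻¹ M`. -/
theorem sum_leverage {ι : Type*} [Fintype ι] {r : ℕ} (v : ι → Fin r → ℝ)
    (hM : IsUnit (infoMatrix v).det) :
    ∑ i, v i ⬝ᵥ ((infoMatrix v)⁻¹ *ᵥ v i) = r := by
  have h : ∀ i, v i ⬝ᵥ ((infoMatrix v)⁻¹ *ᵥ v i) =
      ((infoMatrix v)⁻¹ * vecMulVec (v i) (v i)).trace := fun i => by
    rw [mul_vecMulVec, trace_vecMulVec, dotProduct_comm]
  simp_rw [h]
  rw [← trace_sum, ← Finset.mul_sum]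
  change ((infoMatrix v)⁻¹ * infoMatrix v).trace = r
  rw [nonsing_inv_mul _ hM]
  simp

/-- A family of `k` vectors (with repetitions) from `X` whose information determinant cannot be
increased by exchanging one vector has all leverages at most `r / (k - r + 1)`. -/
theorem leverage_le_of_exchange_optimal {ι : Type*} [Fintype ι] [DecidableEq ι] {r : ℕ}
    (v : ι → Fin r → ℝ) (hM : 0 < (infoMatrix v).det) (x : Fin r → ℝ)
    (hopt : ∀ i, (infoMatrix (Function.update v i x)).det ≤ (infoMatrix v).det) :
    (Fintype.card ι - r + 1) * (x ⬝ᵥ ((infoMatrix v)⁻¹ *ᵥ x)) ≤ r := by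
  have hu : IsUnit (infoMatrix v).det := hM.ne'.isUnit
  set q := x ⬝ᵥ ((infoMatrix v)⁻¹ *ᵥ x) with hq
  have h1 : ∀ i, (1 - v i ⬝ᵥ ((infoMatrix v)⁻¹ *ᵥ v i)) * (1 + q) +
      (v i ⬝ᵥ ((infoMatrix v)⁻¹ *ᵥ x)) ^ 2 ≤ 1 := fun i => by
    have := hopt i
    rw [infoMatrix_update, det_swap_rank_one _ hu (transpose_infoMatrix v)] at this
    exact le_of_mul_le_mul_left (this.trans_eq (mul_one _).symm) hM
  have h2 := Finset.sum_le_sum fun i (_ : i ∈ Finset.univ) => h1 i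
  have h3 : ∑ i, (v i ⬝ᵥ ((infoMatrix v)⁻¹ *ᵥ x)) ^ 2 = q := by
    have := dotProduct_infoMatrix_mulVec v ((infoMatrix v)⁻¹ *ᵥ x) ((infoMatrix v)⁻¹ *ᵥ x)
    rw [mulVec_mulVec, mul_nonsing_inv _ hu, one_mulVec, dotProduct_comm] at this
    rw [hq, this]
    simp [sq]
  -- Summed over the `k` indices, the inequalities read `(k - r)(1 + q) + q ≤ k`.
  rw [Finset.sum_add_distrib, h3, ← Finset.sum_mul, Finset.sum_sub_distrib, sum_leverage v hu] at h2
  simp only [Finset.sum_const, Finset.card_univ, nsmul_eq_mul, mul_one] at h2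
  linarith

/-- A maximizer exists since there are finitely many families, and its determinant is positive
because some competitor `f₀` contains a basis. -/
theorem exists_exact_design {X : Type*} [Finite X] {r : ℕ} (ψ : X → Fin r → ℝ)
    (hψ : Submodule.span ℝ (Set.range ψ) = ⊤) {k : ℕ} (hk : r ≤ k) (hX : Nonempty X) :
    ∃ f : Fin k → X, IsUnit (infoMatrix (ψ ∘ f)).det ∧
      ∀ x, ((k : ℝ) - r + 1) * (ψ x ⬝ᵥ ((infoMatrix (ψ ∘ f))⁻¹ *ᵥ ψ x)) ≤ r := by
  obtain ⟨f, hf⟩ := Finite.exists_max fun f : Fin k → X => (infoMatrix (ψ ∘ f)).det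
  have hr : Module.finrank ℝ (Submodule.span ℝ (Set.range ψ)) = r := by
    rw [hψ, finrank_top]; simp
  obtain ⟨g, hg, hspan, -⟩ := Submodule.exists_fun_fin_finrank_span_eq ℝ (Set.range ψ)
  choose g' hg' using hg
  let f₀ : Fin k → X := fun i =>
    if h : (i : ℕ) < Module.finrank ℝ (Submodule.span ℝ (Set.range ψ)) then g' ⟨i, h⟩
    else hX.some
  have hpos : 0 < (infoMatrix (ψ ∘ f)).det := by
    refine lt_of_lt_of_le ?_ (hf f₀)
    refine (posDef_infoMatrix _ ?_).det_pos
    rw [eq_top_iff, ← hψ, ← hspan, Submodule.span_le]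
    rintro _ ⟨i, rfl⟩
    refine Submodule.subset_span ⟨⟨i, by omega⟩, ?_⟩
    simp [f₀, hg']
  refine ⟨f, hpos.ne'.isUnit, fun x => ?_⟩
  have := leverage_le_of_exchange_optimal (ψ ∘ f) hpos (ψ x) fun i => by
    rw [← Function.comp_update]
    exact hf _
  simpa using this

/-- The weights of the empirical distribution of `f`. -/
theorem exists_weights {X : Type*} {k : ℕ} (hk : 0 < k) (f : Fin k → X) :
    ∃ (𝒦 : Finset X) (ρ : 𝒦 → ℝ), ρ ∈ stdSimplex ℝ 𝒦 ∧ 𝒦.card ≤ k ∧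
      ∀ {V : Type} [AddCommGroup V] [Module ℝ V] (g : X → V),
        ∑ p : 𝒦, ρ p • g p = (k : ℝ)⁻¹ • ∑ i, g (f i) := by
  classical
  let 𝒦 : Finset X := Finset.univ.image f
  let f' : Fin k → 𝒦 := fun i => ⟨f i, Finset.mem_image_of_mem f (Finset.mem_univ i)⟩
  have key : ∀ {V : Type} [AddCommGroup V] [Module ℝ V] (g : X → V),
      ∑ p : 𝒦, ((k : ℝ)⁻¹ * (Finset.univ.filter fun i => f' i = p).card) • g p =
        (k : ℝ)⁻¹ • ∑ i, g (f i) := by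
    intro V _ _ g
    rw [← Finset.sum_fiberwise Finset.univ f' (fun i => g (f i)), Finset.smul_sum]
    refine Finset.sum_congr rfl fun p _ => ?_
    rw [mul_smul]
    congr 1
    rw [Finset.sum_congr rfl (g := fun _ => g p) fun i hi => by
      rw [← (Finset.mem_filter.1 hi).2], Finset.sum_const, Nat.cast_smul_eq_nsmul]
  refine ⟨𝒦, fun p => (k : ℝ)⁻¹ * (Finset.univ.filter fun i => f' i = p).card,
    ⟨fun p => by positivity, ?_⟩, ?_, key⟩
  -- Total mass is the averaging identity for the constant function `1`; the matrix-valued case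
  -- later gives the design matrix.
  · have := key fun _ => (1 : ℝ)
    simp only [smul_eq_mul, mul_one] at this
    rw [this]
    have : (k : ℝ) ≠ 0 := by positivity
    simp [this]
  · exact Finset.card_image_le.trans_eq (by simp)

/-- Fits the support size `2r + 1 ≤ 2d + 1` into the required bound. The iterated logarithm is
negative at `d = 2`, nonnegative for `3 ≤ d ≤ 7` (where `2d + 1 ≤ 15`), and at least `1/2` from `d =
8` on. -/
theorem two_mul_add_one_le_log_log {d : ℕ} (hd : 1 ≤ d) :
    2 * (d : ℝ) + 1 ≤ 4 * d * Real.log (Real.log d) + 16 := by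
  have hl2 := Real.log_two_gt_d9
  rcases Nat.lt_or_ge d 2 with h | h
  · have : d = 1 := by omega
    subst this
    norm_num
  rcases Nat.lt_or_ge d 3 with h3 | h3
  · have : d = 2 := by omega
    subst this
    have h1 := Real.one_sub_inv_le_log_of_pos (show 0 < Real.log 2 by linarith)
    have h2 : (Real.log 2)⁻¹ ≤ (0.69 : ℝ)⁻¹ := by
      apply inv_anti₀ <;> linarith
    norm_num at h1 h2 ⊢
    linarith
  rcases Nat.lt_or_ge d 8 with h8 | h8
  · have h1 : 1 ≤ Real.log d := by
      rw [Real.le_log_iff_exp_le (by positivity)]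
      have : (3 : ℝ) ≤ d := by exact_mod_cast h3
      linarith [Real.exp_one_lt_d9]
    have h2 : 0 ≤ 4 * d * Real.log (Real.log d) := by
      have := Real.log_nonneg h1
      positivity
    have h3 : (d : ℝ) ≤ 7 := by exact_mod_cast (by omega : d ≤ 7)
    linarith
  · have hd8 : (8 : ℝ) ≤ d := by exact_mod_cast h8
    have h1 : 2 ≤ Real.log d := by
      have : Real.log 8 = 3 * Real.log 2 := by
        rw [show (8 : ℝ) = 2 ^ 3 by norm_num, Real.log_pow]; norm_num
      linarith [Real.log_le_log (by norm_num) hd8]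
    have h2 := Real.one_sub_inv_le_log_of_pos (show 0 < Real.log d by linarith)
    have h3 : (Real.log d)⁻¹ ≤ 2⁻¹ := inv_anti₀ (by norm_num) h1
    have h4 : 4 * (d : ℝ) * (1 / 2) ≤ 4 * d * Real.log (Real.log d) := by
      gcongr
      linarith
    linarith

theorem exists_isCoreSet {A B : Type*} [Finite A] [Nonempty A] [Finite B] [Nonempty B] {d : ℕ}
    (hd : 1 ≤ d) (φ : A → B → Fin d → ℝ) :
    ∃ (𝒦 : Finset (A × B)) (ρ : 𝒦 → ℝ), IsCoreSet φ 𝒦 ρ := by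
  -- The features may not span, so the design is built in coordinates `ψ` on their span; `L` maps
  -- the coordinates back to `ℝ^d`.
  let Φ : A × B → Fin d → ℝ := fun p => φ p.1 p.2
  let S := Submodule.span ℝ (Set.range Φ)
  let r := Module.finrank ℝ S
  let bas := Module.finBasis ℝ S
  have hrd : r ≤ d := (Submodule.finrank_le S).trans_eq (by simp)
  let Φ' : A × B → S := fun p => ⟨Φ p, Submodule.subset_span ⟨p, rfl⟩⟩
  let ψ : A × B → Fin r → ℝ := fun p => bas.equivFun (Φ' p)
  have hΦ' : Submodule.span ℝ (Set.range Φ') = ⊤ := by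
    have : Set.range Φ' = Subtype.val ⁻¹' Set.range Φ := by
      ext ⟨x, hx⟩
      simp [Φ', Subtype.ext_iff]
    rw [this]
    exact Submodule.span_span_coe_preimage
  have hψ : Submodule.span ℝ (Set.range ψ) = ⊤ := by
    have : Set.range ψ = bas.equivFun.toLinearMap '' Set.range Φ' := by
      rw [← Set.range_comp]; rfl
    rw [this, Submodule.span_image, hΦ', Submodule.map_top, LinearEquiv.range]
  let L : Matrix (Fin d) (Fin r) ℝ := of fun i j => (bas j : Fin d → ℝ) i
  have hL : ∀ y : Fin r → ℝ, L *ᵥ y = ((bas.equivFun.symm y : S) : Fin d → ℝ) := fun y => by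
    ext i
    simp [L, mulVec, dotProduct, Module.Basis.equivFun_symm_apply, mul_comm]
    rfl
  have hLψ : ∀ p, L *ᵥ ψ p = Φ p := fun p => by
    rw [hL]; simp [ψ, Φ']
  have hLinj : Function.Injective L.mulVec := fun y z h => by
    rw [hL, hL] at h
    exact bas.equivFun.symm.injective (Subtype.ext h)
  have hLsurj : ∀ y : Fin r → ℝ, ∃ w, Lᵀ *ᵥ w = y := by
    obtain ⟨g, hg⟩ := LinearMap.exists_leftInverse_of_injective (toLin' L)
      (LinearMap.ker_eq_bot.2 hLinj)
    have hgL : LinearMap.toMatrix' g * L = 1 := by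
      rw [← LinearMap.toMatrix'_toLin' L, ← LinearMap.toMatrix'_comp, hg, LinearMap.toMatrix'_id]
    intro y
    refine ⟨(LinearMap.toMatrix' g)ᵀ *ᵥ y, ?_⟩
    rw [mulVec_mulVec, ← transpose_mul, hgL, transpose_one, one_mulVec]
  -- With `k = 2r + 1` the leverages are at most `r / (r + 2)`; normalizing the weights multiplies
  -- them by `k`, and `(2r + 1) r / (r + 2) ≤ 2r`.
  obtain ⟨f, hdet, hf⟩ := exists_exact_design ψ hψ (show r ≤ 2 * r + 1 by omega) inferInstance
  obtain ⟨𝒦, ρ, hρ, hcard, hsum⟩ := exists_weights (Nat.succ_pos (2 * r)) f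
  refine ⟨𝒦, ρ, hρ, fun a b => ?_, ?_⟩
  · have hG : designMatrix φ 𝒦 ρ =
        ((2 * r + 1 : ℕ) : ℝ)⁻¹ • (L * infoMatrix (ψ ∘ f) * Lᵀ) := by
      refine (hsum fun p => vecMulVec (Φ p) (Φ p)).trans ?_
      congr 1
      rw [infoMatrix, Matrix.mul_sum, Matrix.sum_mul]
      refine Finset.sum_congr rfl fun i _ => ?_
      rw [mul_vecMulVec, vecMulVec_mul, vecMul_transpose]
      simp only [Function.comp_apply, hLψ]
    -- As `G = k⁻¹ L M Lᵀ`, solving `Lᵀ w = k M⁻¹ ψ` gives `G w = L ψ = φ`.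
    obtain ⟨w, hw⟩ := hLsurj (((2 * r + 1 : ℕ) : ℝ) • ((infoMatrix (ψ ∘ f))⁻¹ *ᵥ ψ (a, b)))
    have hφ : φ a b = L *ᵥ ψ (a, b) := (hLψ (a, b)).symm
    refine ⟨w, ?_, ?_⟩
    · rw [hG, smul_mulVec, ← mulVec_mulVec, hw, mulVec_smul, smul_smul,
        inv_mul_cancel₀ (by positivity), one_smul, mulVec_mulVec, Matrix.mul_assoc,
        mul_nonsing_inv _ hdet, Matrix.mul_one, hφ]
    · rw [hφ, dotProduct_comm, dotProduct_mulVec, ← mulVec_transpose, hw, smul_dotProduct,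
        dotProduct_comm, smul_eq_mul]
      have h1 := hf (a, b)
      set q := ψ (a, b) ⬝ᵥ ((infoMatrix (ψ ∘ f))⁻¹ *ᵥ ψ (a, b))
      have hr' : (r : ℝ) ≤ d := by exact_mod_cast hrd
      have hr0 : (0 : ℝ) ≤ r := by positivity
      push_cast at h1 ⊢
      rcases le_or_gt q 0 with hq | hq
      · nlinarith
      · nlinarith
  · have h1 : ((𝒦.card : ℕ) : ℝ) ≤ ((2 * r + 1 : ℕ) : ℝ) := by exact_mod_cast hcard
    have hr' : (r : ℝ) ≤ d := by exact_mod_cast hrd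
    push_cast at h1
    linarith [two_mul_add_one_le_log_log hd]

/-! ### Stability of best responses and leader values -/

section Comparison

variable {A B : Type*} [Finite B] [Nonempty B]

theorem mem_bestResponse_iff {u : A → B → ℝ} {η : ℝ} {a : A} {b : B} :
    b ∈ bestResponse u η a ↔ ∀ b', u a b' - η ≤ u a b := by
  change (⨆ b', u a b') - η ≤ u a b ↔ _
  rw [sub_le_iff_le_add, ciSup_le_iff (Set.finite_range _).bddAbove]
  simp only [sub_le_iff_le_add]

theorem bestResponse_nonempty (u : A → B → ℝ) {η : ℝ} (hη : 0 ≤ η) (a : A) :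
    (bestResponse u η a).Nonempty := by
  obtain ⟨b, hb⟩ := Finite.exists_max (u a)
  exact ⟨b, mem_bestResponse_iff.2 fun b' => by linarith [hb b']⟩

omit [Nonempty B] in
theorem leaderValue_le {u₁ u₂ : A → B → ℝ} {η : ℝ} {a : A} {b : B}
    (hb : b ∈ bestResponse u₂ η a) : leaderValue u₁ u₂ η a ≤ u₁ a b :=
  csInf_le (Set.toFinite _).bddBelow ⟨b, hb, rfl⟩

theorem le_leaderValue {u₁ u₂ : A → B → ℝ} {η : ℝ} (hη : 0 ≤ η) {a : A} {c : ℝ}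
    (h : ∀ b ∈ bestResponse u₂ η a, c ≤ u₁ a b) : c ≤ leaderValue u₁ u₂ η a := by
  refine le_csInf ((bestResponse_nonempty u₂ hη a).image _) ?_
  rintro _ ⟨b, hb, rfl⟩
  exact h b hb

theorem bestResponse_subset_of_close {u v : A → B → ℝ} {e η η' : ℝ}
    (h : ∀ a b, |u a b - v a b| ≤ e) (hη : η + 2 * e ≤ η') (a : A) :
    bestResponse u η a ⊆ bestResponse v η' a := fun b hb => by
  rw [mem_bestResponse_iff] at hb ⊢
  intro b'
  have h1 := abs_le.1 (h a b)
  have h2 := abs_le.1 (h a b')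
  linarith [hb b', h1.1, h1.2, h2.1, h2.2]

theorem leaderValue_anti (u₁ u₂ : A → B → ℝ) {η η' : ℝ} (hη : 0 ≤ η) (h : η ≤ η') (a : A) :
    leaderValue u₁ u₂ η' a ≤ leaderValue u₁ u₂ η a :=
  le_leaderValue hη fun _ hb =>
    leaderValue_le (bestResponse_subset_of_close (e := 0) (by simp) (by simpa using h) a hb)

/-- An optimizer of the leader's estimated value is near-optimal when all estimates are
`ε/8`-accurate. -/
theorem leaderValue_le_add_of_close [Finite A] {u₁ u₂ v₁ v₂ : A → B → ℝ} {ε : ℝ} (hε : 0 ≤ ε)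
    (h₁ : ∀ a b, |u₁ a b - v₁ a b| ≤ ε / 8) (h₂ : ∀ a b, |u₂ a b - v₂ a b| ≤ ε / 8) {a : A}
    (ha : ∀ a', leaderValue v₁ v₂ (3 * ε / 4) a' ≤ leaderValue v₁ v₂ (3 * ε / 4) a) (a' : A) :
    leaderValue u₁ u₂ ε a' ≤ leaderValue u₁ u₂ (ε / 2) a + ε := by
  have h₂' : ∀ a b, |v₂ a b - u₂ a b| ≤ ε / 8 := fun a b => by rw [abs_sub_comm]; exact h₂ a b
  -- Here `3ε/4 + 2 · ε/8 = ε`; below, `ε/2 + 2 · ε/8 = 3ε/4`. The two leader errors cost only `ε/4`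
  -- in total.
  have hlow : leaderValue u₁ u₂ ε a' - ε / 8 ≤ leaderValue v₁ v₂ (3 * ε / 4) a' :=
    le_leaderValue (by positivity) fun b hb => by
      have := leaderValue_le (u₁ := u₁)
        (bestResponse_subset_of_close (η' := ε) h₂' (by linarith) a' hb)
      linarith [(abs_le.1 (h₁ a' b)).2]
  have hup : leaderValue v₁ v₂ (3 * ε / 4) a - ε / 8 ≤ leaderValue u₁ u₂ (ε / 2) a :=
    le_leaderValue (by positivity) fun b hb => by
      have := leaderValue_le (u₁ := v₁)
        (bestResponse_subset_of_close (η' := 3 * ε / 4) h₂ (by linarith) a hb)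
      linarith [(abs_le.1 (h₁ a b)).1]
  linarith [ha a']

end Comparison

/-! ### Weighted least squares on a core set -/

section LeastSquares

variable {A B : Type*} {d : ℕ} {φ : A → B → Fin d → ℝ} {𝒦 : Finset (A × B)} {ρ : 𝒦 → ℝ}

theorem dotProduct_designMatrix_mulVec (x y : Fin d → ℝ) :
    x ⬝ᵥ (designMatrix φ 𝒦 ρ *ᵥ y) =
      ∑ p : 𝒦, ρ p * ((φ p.1.1 p.1.2 ⬝ᵥ x) * (φ p.1.1 p.1.2 ⬝ᵥ y)) := by
  simp only [designMatrix, sum_mulVec, dotProduct_sum, smul_mulVec, vecMulVec_mulVec_eq_smul,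
    dotProduct_smul, smul_eq_mul]
  exact Finset.sum_congr rfl fun i _ => by rw [dotProduct_comm x (φ _ _), mul_comm (_ ⬝ᵥ y)]

theorem sum_sq_residual_add (m : 𝒦 → ℝ) (θ x : Fin d → ℝ) :
    ∑ p : 𝒦, ρ p * (φ p.1.1 p.1.2 ⬝ᵥ (θ + x) - m p) ^ 2 =
      ∑ p : 𝒦, ρ p * (φ p.1.1 p.1.2 ⬝ᵥ θ - m p) ^ 2 +
        2 * ∑ p : 𝒦, ρ p * ((φ p.1.1 p.1.2 ⬝ᵥ θ - m p) * (φ p.1.1 p.1.2 ⬝ᵥ x)) +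
        ∑ p : 𝒦, ρ p * (φ p.1.1 p.1.2 ⬝ᵥ x) ^ 2 := by
  rw [Finset.mul_sum, ← Finset.sum_add_distrib, ← Finset.sum_add_distrib]
  refine Finset.sum_congr rfl fun p _ => ?_
  rw [dotProduct_add]
  ring

/-- The normal equations. -/
theorem isWeightedLeastSquares_iff (hρ : ∀ p, 0 ≤ ρ p) (m : 𝒦 → ℝ) (θ : Fin d → ℝ) :
    IsWeightedLeastSquares φ 𝒦 ρ m θ ↔
      ∀ x, ∑ p : 𝒦, ρ p * ((φ p.1.1 p.1.2 ⬝ᵥ θ - m p) * (φ p.1.1 p.1.2 ⬝ᵥ x)) = 0 := by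
  constructor
  · intro h x
    set s := ∑ p : 𝒦, ρ p * ((φ p.1.1 p.1.2 ⬝ᵥ θ - m p) * (φ p.1.1 p.1.2 ⬝ᵥ x)) with hs
    set Q := ∑ p : 𝒦, ρ p * (φ p.1.1 p.1.2 ⬝ᵥ x) ^ 2 with hQ
    -- Along the line `θ + t x` the excess loss is a quadratic in `t` without constant term; its
    -- discriminant `4 s²` must be nonpositive.
    have key : ∀ t : ℝ, 0 ≤ Q * (t * t) + 2 * s * t + 0 := fun t => by
      have := h (θ + t • x)
      rw [sum_sq_residual_add] at this
      have h1 : ∑ p : 𝒦, ρ p * ((φ p.1.1 p.1.2 ⬝ᵥ θ - m p) * (φ p.1.1 p.1.2 ⬝ᵥ (t • x))) =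
          t * s := by
        rw [hs, Finset.mul_sum]
        exact Finset.sum_congr rfl fun p _ => by rw [dotProduct_smul, smul_eq_mul]; ring
      have h2 : ∑ p : 𝒦, ρ p * (φ p.1.1 p.1.2 ⬝ᵥ (t • x)) ^ 2 = t * t * Q := by
        rw [hQ, Finset.mul_sum]
        exact Finset.sum_congr rfl fun p _ => by rw [dotProduct_smul, smul_eq_mul]; ring
      rw [h1, h2] at this
      linarith
    have := discrim_le_zero key
    rw [discrim] at this
    nlinarith [sq_nonneg s]
  · intro h θ'
    have h1 := sum_sq_residual_add (φ := φ) (ρ := ρ) m θ (θ' - θ)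
    rw [h, add_sub_cancel] at h1
    have h2 : 0 ≤ ∑ p : 𝒦, ρ p * (φ p.1.1 p.1.2 ⬝ᵥ (θ' - θ)) ^ 2 :=
      Finset.sum_nonneg fun p _ => mul_nonneg (hρ p) (sq_nonneg _)
    linarith

/-- Each core feature is `G w` for some `w`, so the combination of the `w p` with coefficients `ρ p
* m p` solves the normal equations, even for singular `G`. -/
theorem exists_isWeightedLeastSquares (h : IsCoreSet φ 𝒦 ρ) (m : 𝒦 → ℝ) :
    ∃ θ, IsWeightedLeastSquares φ 𝒦 ρ m θ := by
  choose w hw _ using fun p : 𝒦 => h.2.1 p.1.1 p.1.2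
  refine ⟨∑ p, (ρ p * m p) • w p, (isWeightedLeastSquares_iff h.1.1 _ _).2 fun x => ?_⟩
  have h1 := dotProduct_designMatrix_mulVec (φ := φ) (ρ := ρ) x (∑ p, (ρ p * m p) • w p)
  rw [mulVec_sum, dotProduct_sum] at h1
  simp only [mulVec_smul, hw, dotProduct_smul, smul_eq_mul] at h1
  simp only [sub_mul, mul_sub, Finset.sum_sub_distrib]
  rw [sub_eq_zero]
  calc _ = _ := Finset.sum_congr rfl fun p _ => by rw [mul_comm (_ ⬝ᵥ _)]
    _ = _ := h1.symm
    _ = _ := Finset.sum_congr rfl fun p _ => by rw [dotProduct_comm x]; ring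

/-- If the targets have error at most `t` on the core set, then the least squares estimate has
error at most `t √(2d)` on every pair. -/
theorem abs_sub_le_of_isWeightedLeastSquares (h : IsCoreSet φ 𝒦 ρ) {m : 𝒦 → ℝ}
    {θ θ₀ : Fin d → ℝ} (hθ : IsWeightedLeastSquares φ 𝒦 ρ m θ) {t : ℝ} (ht : 0 ≤ t)
    (hm : ∀ p : 𝒦, |m p - φ p.1.1 p.1.2 ⬝ᵥ θ₀| ≤ t) (a : A) (b : B) :
    |φ a b ⬝ᵥ θ₀ - φ a b ⬝ᵥ θ| ≤ t * √(2 * d) := by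
  obtain ⟨w, hw, hwd⟩ := h.2.1 a b
  have hρ := h.1.1
  have hρ1 : ∑ p, ρ p = 1 := h.1.2
  have hN := (isWeightedLeastSquares_iff hρ m θ).1 hθ w
  have e1 : φ a b ⬝ᵥ θ₀ - φ a b ⬝ᵥ θ =
      -∑ p : 𝒦, ρ p * ((m p - φ p.1.1 p.1.2 ⬝ᵥ θ₀) * (φ p.1.1 p.1.2 ⬝ᵥ w)) := by
    have h1 : φ a b ⬝ᵥ θ₀ - φ a b ⬝ᵥ θ = (θ₀ - θ) ⬝ᵥ (designMatrix φ 𝒦 ρ *ᵥ w) := by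
      rw [hw, sub_dotProduct, dotProduct_comm, dotProduct_comm θ]
    rw [h1, dotProduct_designMatrix_mulVec, ← sub_eq_zero, sub_neg_eq_add,
      ← Finset.sum_add_distrib, ← neg_eq_zero, ← hN, ← Finset.sum_neg_distrib]
    exact Finset.sum_congr rfl fun p _ => by rw [dotProduct_sub]; ring
  have e2 : ∑ p : 𝒦, ρ p * (φ p.1.1 p.1.2 ⬝ᵥ w) ^ 2 ≤ 2 * d := by
    refine le_trans (le_of_eq ?_) hwd
    rw [← hw, dotProduct_comm, dotProduct_designMatrix_mulVec]
    exact Finset.sum_congr rfl fun p _ => by ring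
  -- Cauchy–Schwarz for the probability weights `ρ`: the first moment is at most the root of the
  -- second, which is `wᵀ G w = φᵀ w ≤ 2d`.
  have e3 : ∑ p : 𝒦, ρ p * |φ p.1.1 p.1.2 ⬝ᵥ w| ≤ √(2 * d) := by
    refine Real.le_sqrt_of_sq_le (le_trans ?_ e2)
    have cs := Finset.sum_sq_le_sum_mul_sum_of_sq_le_mul Finset.univ
      (r := fun p : 𝒦 => ρ p * |φ p.1.1 p.1.2 ⬝ᵥ w|) (f := ρ)
      (g := fun p : 𝒦 => ρ p * (φ p.1.1 p.1.2 ⬝ᵥ w) ^ 2) (fun p _ => hρ p)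
      (fun p _ => mul_nonneg (hρ p) (sq_nonneg _))
      (fun p _ => by rw [mul_pow, sq_abs]; exact le_of_eq (by ring))
    rwa [hρ1, one_mul] at cs
  rw [e1, abs_neg]
  calc _ ≤ ∑ p : 𝒦, |ρ p * ((m p - φ p.1.1 p.1.2 ⬝ᵥ θ₀) * (φ p.1.1 p.1.2 ⬝ᵥ w))| :=
        Finset.abs_sum_le_sum_abs _ _
    _ ≤ ∑ p : 𝒦, t * (ρ p * |φ p.1.1 p.1.2 ⬝ᵥ w|) := Finset.sum_le_sum fun p _ => by
        rw [abs_mul, abs_mul, abs_of_nonneg (hρ p)]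
        have := mul_le_mul_of_nonneg_right (hm p)
          (mul_nonneg (hρ p) (abs_nonneg (φ p.1.1 p.1.2 ⬝ᵥ w)))
        linarith
    _ = t * ∑ p : 𝒦, ρ p * |φ p.1.1 p.1.2 ⬝ᵥ w| := by rw [Finset.mul_sum]
    _ ≤ _ := mul_le_mul_of_nonneg_left e3 ht

theorem exists_isOutput [Finite A] [Nonempty A] [Finite B] [Nonempty B] (h : IsCoreSet φ 𝒦 ρ)
    {N : ℕ} {ε : ℝ} (hε : 0 ≤ ε) (X : Observations 𝒦 N) : ∃ a b, IsOutput φ 𝒦 ρ ε X a b := by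
  choose θ hθ using fun i => exists_isWeightedLeastSquares h (empiricalMean X i)
  obtain ⟨a, ha⟩ := Finite.exists_max fun a => leaderValue (fun a b => φ a b ⬝ᵥ θ 0)
    (fun a b => φ a b ⬝ᵥ θ 1) (3 * ε / 4) a
  obtain ⟨b, hb, hmin⟩ := Set.exists_min_image _ (fun b => φ a b ⬝ᵥ θ 0) (Set.toFinite _)
    (bestResponse_nonempty (fun a b => φ a b ⬝ᵥ θ 1) (show 0 ≤ 3 * ε / 4 by positivity) a)
  exact ⟨a, b, θ, hθ, ha, hb, hmin⟩

end LeastSquares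

/-! ### Sub-Gaussian concentration of the empirical means -/

section Concentration

variable {A B : Type*} {d : ℕ} (M : LinearBanditGame A B d)

theorem LinearBanditGame.measurable_reward (a : A) (b : B) : Measurable (M.reward a b) := by
  unfold LinearBanditGame.reward
  fun_prop

theorem LinearBanditGame.hasSubgaussianMGF_rewardLaw (a : A) (b : B) (i : Fin 2) :
    HasSubgaussianMGF (fun r : Fin 2 → ℝ => r i - M.feature a b ⬝ᵥ M.theta i) 1
      (M.rewardLaw a b) := by
  rw [← HasSubgaussianMGF.id_map_iff (Measurable.aemeasurable (by fun_prop)), LinearBanditGame.rewardLaw,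
    Measure.map_map (by fun_prop) (M.measurable_reward a b)]
  have : (fun r : Fin 2 → ℝ => r i - M.feature a b ⬝ᵥ M.theta i) ∘ M.reward a b =
      fun z => z i := by
    ext z
    simp [LinearBanditGame.reward]
  rw [this, HasSubgaussianMGF.id_map_iff (measurable_pi_apply i).aemeasurable]
  exact M.noise_subgaussian a b i

theorem LinearBanditGame.mean_eq (i : Fin 2) (a : A) (b : B) :
    M.mean i a b = M.feature a b ⬝ᵥ M.theta i := by
  have := M.noise_prob a b
  rw [LinearBanditGame.mean, LinearBanditGame.rewardLaw,
    integral_map (M.measurable_reward a b).aemeasurable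
      (measurable_pi_apply i).aestronglyMeasurable]
  simp only [LinearBanditGame.reward]
  rw [integral_add (integrable_const _) (M.noise_subgaussian a b i).integrable, M.noise_mean]
  simp

variable (𝒦 : Finset (A × B)) (N : ℕ)

instance : IsProbabilityMeasure (M.observationLaw 𝒦 N) := by
  unfold LinearBanditGame.observationLaw
  infer_instance

/-- The sum of the centered observations at one core set pair is `N`-sub-Gaussian. -/
theorem LinearBanditGame.hasSubgaussianMGF_sum (i : Fin 2) (p : 𝒦) :
    HasSubgaussianMGF (fun X : Observations 𝒦 N =>
      ∑ n : Fin N, (X (p, n) i - M.feature p.1.1 p.1.2 ⬝ᵥ M.theta i)) N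
      (M.observationLaw 𝒦 N) := by
  have hind : iIndepFun (fun (q : Query 𝒦 N) (X : Observations 𝒦 N) =>
      X q i - M.feature q.1.1.1 q.1.1.2 ⬝ᵥ M.theta i) (M.observationLaw 𝒦 N) :=
    iIndepFun_pi (μ := fun q : Query 𝒦 N => M.rewardLaw q.1.1.1 q.1.1.2)
      (X := fun q r => r i - M.feature q.1.1.1 q.1.1.2 ⬝ᵥ M.theta i)
      fun q => Measurable.aemeasurable (by fun_prop)
  have hinj : Function.Injective fun n : Fin N => ((p, n) : Query 𝒦 N) :=
    fun _ _ h => (Prod.ext_iff.1 h).2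
  have hsub : ∀ n : Fin N, HasSubgaussianMGF (fun X : Observations 𝒦 N =>
      X (p, n) i - M.feature p.1.1 p.1.2 ⬝ᵥ M.theta i) 1 (M.observationLaw 𝒦 N) := fun n => by
    refine HasSubgaussianMGF.of_map (μ := M.observationLaw 𝒦 N)
      (Y := fun X : Observations 𝒦 N => X (p, n)) (measurable_pi_apply _).aemeasurable
      (X := fun r : Fin 2 → ℝ => r i - M.feature p.1.1 p.1.2 ⬝ᵥ M.theta i) ?_
    have hmap : (M.observationLaw 𝒦 N).map (fun X => X (p, n)) = M.rewardLaw p.1.1 p.1.2 :=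
      (measurePreserving_eval (fun q : Query 𝒦 N => M.rewardLaw q.1.1.1 q.1.1.2) (p, n)).map_eq
    rw [hmap]
    exact M.hasSubgaussianMGF_rewardLaw _ _ i
  simpa using HasSubgaussianMGF.sum_of_iIndepFun (hind.precomp hinj) (c := fun _ => 1)
    (s := Finset.univ) fun n _ => hsub n

variable {N}

theorem LinearBanditGame.measureReal_abs_empiricalMean_sub_gt_le (hN : 0 < N) (i : Fin 2) (p : 𝒦)
    {t : ℝ} (ht : 0 ≤ t) :
    (M.observationLaw 𝒦 N).real
      {X | t < |empiricalMean X i p - M.feature p.1.1 p.1.2 ⬝ᵥ M.theta i|} ≤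
      2 * Real.exp (-(N * t ^ 2 / 2)) := by
  have hN' : (0 : ℝ) < N := by exact_mod_cast hN
  have h := M.hasSubgaussianMGF_sum 𝒦 N i p
  have h1 := h.measure_ge_le (ε := N * t) (by positivity)
  have h2 := h.neg.measure_ge_le (ε := N * t) (by positivity)
  have he : -(N * t) ^ 2 / (2 * ((N : NNReal) : ℝ)) = -(N * t ^ 2 / 2) := by
    simp only [NNReal.coe_natCast]
    field_simp
  rw [he] at h1 h2
  refine le_trans (measureReal_mono ?_) ((measureReal_union_le _ _).trans
    ((add_le_add h1 h2).trans_eq (two_mul _).symm))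
  intro X hX
  have hX' : t < |empiricalMean X i p - M.feature p.1.1 p.1.2 ⬝ᵥ M.theta i| := hX
  have hS : ∑ n : Fin N, (X (p, n) i - M.feature p.1.1 p.1.2 ⬝ᵥ M.theta i) =
      N * (empiricalMean X i p - M.feature p.1.1 p.1.2 ⬝ᵥ M.theta i) := by
    rw [empiricalMean, Finset.sum_sub_distrib, mul_sub, mul_div_cancel₀ _ hN'.ne']
    simp
  simp only [Set.mem_union, Set.mem_ofPred_eq, Pi.neg_apply, hS, ← mul_neg]
  rcases lt_abs.1 hX' with h | h
  · exact Or.inl (by gcongr)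
  · exact Or.inr (by gcongr)

/-- The event that all empirical means on the core set are `t`-accurate. -/
def LinearBanditGame.accurateEvent (t : ℝ) : Set (Observations 𝒦 N) :=
  {X | ∀ i p, |empiricalMean X i p - M.feature p.1.1 p.1.2 ⬝ᵥ M.theta i| ≤ t}

theorem LinearBanditGame.measurableSet_accurateEvent (t : ℝ) :
    MeasurableSet (M.accurateEvent 𝒦 t : Set (Observations 𝒦 N)) := by
  unfold LinearBanditGame.accurateEvent empiricalMean
  simp only [Set.ofPred_forall]
  refine MeasurableSet.iInter fun i => MeasurableSet.iInter fun p => ?_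
  exact measurableSet_le (by fun_prop) measurable_const

/-- Union bound over two players and `|𝒦|` pairs; the two tails give the remaining factor `2`. -/
theorem LinearBanditGame.le_measure_accurateEvent (hN : 0 < N) {t δ : ℝ} (ht : 0 ≤ t)
    (hδ : 4 * 𝒦.card * Real.exp (-(N * t ^ 2 / 2)) ≤ δ) :
    ENNReal.ofReal (1 - δ) ≤ M.observationLaw 𝒦 N (M.accurateEvent 𝒦 t) := by
  have hc : (M.observationLaw 𝒦 N).real (M.accurateEvent 𝒦 t)ᶜ ≤ δ := by
    have : (M.accurateEvent 𝒦 t : Set (Observations 𝒦 N))ᶜ = ⋃ q : Fin 2 × 𝒦,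
        {X | t < |empiricalMean X q.1 q.2 - M.feature q.2.1.1 q.2.1.2 ⬝ᵥ M.theta q.1|} := by
      ext X
      simp only [LinearBanditGame.accurateEvent, Set.mem_compl_iff, Set.mem_ofPred_eq, not_forall,
        not_le, Set.mem_iUnion, Prod.exists]
    rw [this]
    refine (measureReal_iUnion_fintype_le _).trans ((Finset.sum_le_sum fun q _ =>
      M.measureReal_abs_empiricalMean_sub_gt_le 𝒦 hN q.1 q.2 ht).trans (le_trans ?_ hδ))
    simp only [Finset.sum_const, Finset.card_univ, Fintype.card_prod, Fintype.card_fin,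
      Fintype.card_coe, nsmul_eq_mul]
    push_cast
    linarith
  rw [probReal_compl_eq_one_sub (M.measurableSet_accurateEvent 𝒦 t)] at hc
  exact ENNReal.ofReal_le_of_le_toReal (by change 1 - δ ≤ (M.observationLaw 𝒦 N).real _; linarith)

end Concentration

/-! ### Bounds on the core set size and the sample size -/

section Counting

theorem log_log_le (d : ℕ) : Real.log (Real.log d) ≤ Real.log (1 + Real.log d) := by
  have h0 : 0 ≤ Real.log d := Real.log_natCast_nonneg d
  rcases h0.eq_or_lt with h | h
  · rw [← h]; simp
  · exact Real.log_le_log h (by linarith)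

theorem log_one_add_log_nonneg (d : ℕ) : 0 ≤ Real.log (1 + Real.log d) :=
  Real.log_nonneg (by linarith [Real.log_natCast_nonneg d])

theorem card_le_of_isCoreSet {A B : Type*} {d : ℕ} (hd : 1 ≤ d) {φ : A → B → Fin d → ℝ}
    {𝒦 : Finset (A × B)} {ρ : 𝒦 → ℝ} (h : IsCoreSet φ 𝒦 ρ) :
    (𝒦.card : ℝ) ≤ 16 * d * (1 + Real.log (1 + Real.log d)) := by
  have hd' : (1 : ℝ) ≤ d := by exact_mod_cast hd
  have h1 := mul_le_mul_of_nonneg_left (log_log_le d) (show (0 : ℝ) ≤ 4 * d by positivity)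
  have h2 := mul_nonneg (show (0 : ℝ) ≤ d by positivity) (log_one_add_log_nonneg d)
  linarith [h.2.2]

/-- A crude polynomial bound suffices in the union bound, where only `log |𝒦|` matters. -/
theorem card_le_sq_of_isCoreSet {A B : Type*} {d : ℕ} (hd : 1 ≤ d) {φ : A → B → Fin d → ℝ}
    {𝒦 : Finset (A × B)} {ρ : 𝒦 → ℝ} (h : IsCoreSet φ 𝒦 ρ) : (𝒦.card : ℝ) ≤ 16 * d ^ 2 := by
  have hd' : (1 : ℝ) ≤ d := by exact_mod_cast hd
  have h0 := Real.log_natCast_nonneg d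
  have h1 : Real.log (1 + Real.log d) ≤ Real.log d := by
    linarith [Real.log_le_sub_one_of_pos (show 0 < 1 + Real.log d by linarith)]
  have h2 : Real.log d ≤ d - 1 := Real.log_le_sub_one_of_pos (by linarith)
  have h3 : 16 * (d : ℝ) * (1 + Real.log (1 + Real.log d)) ≤ 16 * d * d := by
    gcongr; linarith
  linarith [card_le_of_isCoreSet hd h]

theorem half_le_log_two_mul_div {d : ℕ} (hd : 1 ≤ d) {δ : ℝ} (hδ : 0 < δ) (hδ1 : δ < 1) :
    1 / 2 ≤ Real.log (2 * d / δ) := by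
  have hd' : (1 : ℝ) ≤ d := by exact_mod_cast hd
  have : (2 : ℝ) ≤ 2 * d / δ := by
    rw [le_div_iff₀ hδ]; nlinarith
  linarith [Real.log_le_log (by norm_num) this, Real.log_two_gt_d9]

/-- The `+ 1` from rounding up is absorbed because `log (2d/δ) ≥ 1/2`; this is why `C` becomes `C +
2`. -/
theorem repetitions_le {C : ℝ} (hC : 0 ≤ C) {d : ℕ} (hd : 1 ≤ d) {ε δ : ℝ} (hε : 0 < ε)
    (hε1 : ε < 1) (hδ : 0 < δ) (hδ1 : δ < 1) :
    (repetitions C d ε δ : ℝ) ≤ (C + 2) * d * Real.log (2 * d / δ) / ε ^ 2 := by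
  have hd' : (1 : ℝ) ≤ d := by exact_mod_cast hd
  have hL := half_le_log_two_mul_div hd hδ hδ1
  set L := Real.log (2 * d / δ)
  have h1 : (repetitions C d ε δ : ℝ) ≤ C * d * L / ε ^ 2 + 1 :=
    (Nat.ceil_lt_add_one (by positivity)).le
  have h2 : 1 ≤ 2 * d * L / ε ^ 2 := by
    rw [le_div_iff₀ (by positivity)]
    nlinarith
  calc _ ≤ _ := h1
    _ ≤ C * d * L / ε ^ 2 + 2 * d * L / ε ^ 2 := by linarith
    _ = _ := by ring

theorem union_bound_le {d : ℕ} (hd : 1 ≤ d) {δ : ℝ} (hδ : 0 < δ) (hδ1 : δ < 1) {k x : ℝ}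
    (hk : k ≤ 16 * d ^ 2) (hx : 8 * Real.log (2 * d / δ) ≤ x) :
    4 * k * Real.exp (-x) ≤ δ := by
  have hd' : (1 : ℝ) ≤ d := by exact_mod_cast hd
  -- The eighth power beats the prefactor: `64 d² (δ/(2d))⁸ = 64 d² δ⁸ / (256 d⁸) ≤ δ`.
  have h1 : Real.exp (-x) ≤ (δ / (2 * d)) ^ 8 := by
    calc Real.exp (-x) ≤ Real.exp (8 * Real.log (δ / (2 * d))) := by
          rw [← inv_div, Real.log_inv]
          gcongr
          linarith
      _ = _ := by
          rw [mul_comm, Real.exp_mul, Real.exp_log (by positivity)]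
          norm_cast
  have h2 : δ ^ 8 ≤ δ := pow_le_of_le_one hδ.le hδ1.le (by norm_num)
  have h3 : (d : ℝ) ^ 2 ≤ d ^ 8 := pow_le_pow_right₀ hd' (by norm_num)
  calc 4 * k * Real.exp (-x) ≤ 4 * (16 * d ^ 2) * (δ / (2 * d)) ^ 8 := by gcongr
    _ = 64 * d ^ 2 * δ ^ 8 / (256 * d ^ 8) := by rw [div_pow, mul_pow]; norm_num; ring
    _ ≤ δ := by
      rw [div_le_iff₀ (by positivity)]
      have : 64 * (d : ℝ) ^ 2 * δ ^ 8 ≤ 64 * d ^ 8 * δ := by gcongr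
      nlinarith [mul_pos (show (0 : ℝ) < d ^ 8 by positivity) hδ]

end Counting

end Stackelberg

/-! ### Assembly -/

theorem mainTheorem5 :
    ∃ C C' : ℝ, 0 < C ∧ 0 < C' ∧
      ∀ (A B : Type*) [Finite A] [Nonempty A] [Finite B] [Nonempty B] (d : ℕ), 1 ≤ d →
      ∀ M : Stackelberg.LinearBanditGame A B d,
      ∀ ε δ : ℝ, 0 < ε → ε < 1 → 0 < δ → δ < 1 →
        -- the core set subroutine can succeed
        (∃ (𝒦 : Finset (A × B)) (ρ : 𝒦 → ℝ), Stackelberg.IsCoreSet M.feature 𝒦 ρ) ∧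
        -- and whichever core set it returns:
        ∀ (𝒦 : Finset (A × B)) (ρ : 𝒦 → ℝ), Stackelberg.IsCoreSet M.feature 𝒦 ρ →
          -- the algorithm always has an output
          (∀ X : Stackelberg.Observations 𝒦 (Stackelberg.repetitions C d ε δ),
            ∃ a b, Stackelberg.IsOutput M.feature 𝒦 ρ ε X a b) ∧
          -- with probability at least `1 - δ`, every possible output is good
          (∃ E : Set (Stackelberg.Observations 𝒦 (Stackelberg.repetitions C d ε δ)),
            MeasurableSet E ∧
            ENNReal.ofReal (1 - δ) ≤
              M.observationLaw 𝒦 (Stackelberg.repetitions C d ε δ) E ∧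
            ∀ X ∈ E, ∀ a b, Stackelberg.IsOutput M.feature 𝒦 ρ ε X a b →
              Stackelberg.leaderValue (M.mean 0) (M.mean 1) (ε / 2) a ≤
                Stackelberg.leaderValue (M.mean 0) (M.mean 1) 0 a ∧
              (⨆ a' : A, Stackelberg.leaderValue (M.mean 0) (M.mean 1) 0 a') -
                  Stackelberg.gap (M.mean 0) (M.mean 1) ε - ε ≤
                Stackelberg.leaderValue (M.mean 0) (M.mean 1) (ε / 2) a ∧
              b ∈ Stackelberg.bestResponse (M.mean 1) ε a) ∧
          -- the number of queries
          (Nat.card (Stackelberg.Query 𝒦 (Stackelberg.repetitions C d ε δ)) : ℝ) ≤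
            C' * d ^ 2 * Real.log (2 * d / δ) * (1 + Real.log (1 + Real.log d)) / ε ^ 2 := by
  -- `2048 = 8 · 256`: the tail exponent is `N t² / 2 = N ε² / (256 d)` and must reach `8 log
  -- (2d/δ)`. The second constant multiplies the bounds for `|𝒦|` and `N`.
  refine ⟨2048, 16 * (2048 + 2), by norm_num, by norm_num, ?_⟩
  intro A B _ _ _ _ d hd M ε δ hε hε1 hδ hδ1
  refine ⟨Stackelberg.exists_isCoreSet hd M.feature, fun 𝒦 ρ h => ?_⟩
  have hd' : (1 : ℝ) ≤ d := by exact_mod_cast hd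
  have hL := Stackelberg.half_le_log_two_mul_div hd hδ hδ1
  have hNle : 2048 * d * Real.log (2 * d / δ) / ε ^ 2 ≤
      (Stackelberg.repetitions 2048 d ε δ : ℝ) := Nat.le_ceil _
  have hNub := Stackelberg.repetitions_le (C := 2048) (by norm_num) hd hε hε1 hδ hδ1
  set N := Stackelberg.repetitions 2048 d ε δ
  have hN : 0 < N := by
    have : 0 < 2048 * d * Real.log (2 * d / δ) / ε ^ 2 := by positivity
    exact_mod_cast this.trans_le hNle
  refine ⟨fun X => Stackelberg.exists_isOutput h hε.le X, ?_, ?_⟩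
  -- Least squares amplifies errors by `√(2d)`, so this accuracy on the core set yields `ε/8`
  -- everywhere.
  · set t := ε / 8 / √(2 * d) with ht
    have hsq : √(2 * (d : ℝ)) ^ 2 = 2 * d := Real.sq_sqrt (by positivity)
    have hs : 0 < √(2 * (d : ℝ)) := Real.sqrt_pos.2 (by positivity)
    refine ⟨M.accurateEvent 𝒦 t, M.measurableSet_accurateEvent 𝒦 t,
      M.le_measure_accurateEvent 𝒦 hN (by positivity)
        (Stackelberg.union_bound_le hd hδ hδ1 (Stackelberg.card_le_sq_of_isCoreSet hd h) ?_), ?_⟩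
    · rw [ht, div_pow, hsq, div_pow]
      rw [div_le_iff₀ (by positivity)] at hNle
      have : (N : ℝ) * (ε ^ 2 / 8 ^ 2 / (2 * d)) / 2 = N * ε ^ 2 / (256 * d) := by
        field_simp
        norm_num
      rw [this, le_div_iff₀ (by positivity)]
      linarith
    · rintro X hX a b ⟨θ, hθ, ha, hb, -⟩
      have hclose : ∀ i a b, |M.mean i a b - M.feature a b ⬝ᵥ θ i| ≤ ε / 8 := fun i a b => by
        have := Stackelberg.abs_sub_le_of_isWeightedLeastSquares h (hθ i)
          (show 0 ≤ t by positivity) (hX i) a b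
        rwa [← M.mean_eq, ht, div_mul_cancel₀ _ hs.ne'] at this
      refine ⟨Stackelberg.leaderValue_anti _ _ le_rfl (by positivity) a, ?_,
        Stackelberg.bestResponse_subset_of_close (e := ε / 8) (fun a b => ?_) (by linarith) a hb⟩
      -- Subtracting the gap from `max φ₀` leaves exactly `max φ_ε`.
      · have := ciSup_le (Stackelberg.leaderValue_le_add_of_close hε.le (hclose 0) (hclose 1) ha)
        rw [Stackelberg.gap]
        linarith
      · rw [abs_sub_comm]
        exact hclose 1 a b
  · have hK := Stackelberg.card_le_of_isCoreSet hd h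
    have hlog := Stackelberg.log_one_add_log_nonneg d
    rw [Nat.card_eq_fintype_card, Fintype.card_prod, Fintype.card_fin, Fintype.card_coe]
    push_cast
    calc (𝒦.card : ℝ) * N ≤ 16 * d * (1 + Real.log (1 + Real.log d)) *
          ((2048 + 2) * d * Real.log (2 * d / δ) / ε ^ 2) := by gcongr
      _ = _ := by ring
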